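/- Let $d\ge 1$, $\alpha\in(0,1]$, $0<q_{\min}<q_*$, $q_{\max},B_\alpha\in\mathbb{R}$, $0<\rho_{\min}$ and $\rho_{\max}\in\mathbb R$. Let $\rho_0,\rho_T$ be probability densities supported on $[0,1]^d$ with $\rho_{\min}\le \rho_0,\rho_T\le\rho_{\max}$ on $[0,1]^d$. Let $\mathcal{Q}_\alpha(q_{\min},q_{\max})$ be the class of all continuous, strictly positive transition densities $q=q(0,\cdot;T,\cdot)$ on $\mathbb{R}^d\times\mathbb{R}^d$ (so $\int_{\mathbb{R}^d} q(0,x;T,z)\,dz=1$ for all $x$) such that $$q_{\min}\le q(0,x;T,z)\le q_{\max}\quad (x,z\in[0,1]^d),\qquad \sup_{z\in[0,1]^d}\bigl\|q(0,\cdot;T,z)\,\rho_0(\cdot)\bigr\|_{\mathcal{H}^{1,\alpha}([0,1]^d)}\le B_\alpha .$$ Here $\mathcal H^{1,\alpha}([0,1]^d)$ is the space of $C^1$ functions $f$ on $U=(0,1)^d$ that are uniformly continuous together with their first partial derivatives and whose first partial derivatives are uniformly $\alpha$-Hölder continuous, with norm $$\|f\|_{\mathcal{H}^{1,\alpha}}=\max\Bigl(\sup_U|f|,\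 \max_i\sup_U|\partial_i f|,\ \max_i\sup_{x\ne y\in U}\frac{|\partial_i f(x)-\partial_i f(y)|}{|x-y|^{\alpha}}\Bigr),$$ where $|\cdot|$ is the max-norm on $\mathbb{R}^d$. Assume that the lower bound $q_{\min}$ is not sharp, in the sense that $\mathcal{Q}_\alpha(q_*,q_{\max})$ (same $\rho_0$, same $B_\alpha$) is non-empty. For $q\in\mathcal{Q}_\alpha(q_{\min},q_{\max})$ let $g^\star$ be the continuous, strictly positive function on $[0,1]^d$ with $\int_{[0,1]^d} g^\star(z)\,dz=1$ that solves $$\int_{[0,1]^d}\frac{\rho_0(x)}{\int_{[0,1]^d}q(0,x;T,z')\frac{\rho_T(z')}{g^\star(z')}\,dz'}\,q(0,x;T,z)\,dx=g^\star(z),\qquad z\in[0,1]^d .$$ For functions $f,g$ on $[0,1]^d$ let $d_H(f,g)=\log\bigl(M(f,g)/m(f,g)\bigr)$ be the Hilbert metric, where $M(f,g)=\inf\{\lambda>0: f\le\lambda g\text{ a.e.}\}$ (with $\inf\varnothing=\infty$), $m(f,g)=\sup\{\lambda>0:\lambda g\le f\text{ a.e.}\}$ (with $\sup\varnothing=0$),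 and $d_H(f,g)=\infty$ if $m(f,g)=0$ or $M(f,g)=\infty$. Then there is a constant $c>0$, depending only on $d,\alpha,q_{\min},q_*,q_{\max},B_\alpha,\rho_{\min},\rho_{\max}$ (and not on $\rho_0$, $\rho_T$ or $N$), such that for every $N\ge1$ $$\inf_{\widehat g}\ \sup_{q\in\mathcal{Q}_\alpha(q_{\min},q_{\max})}\mathbb{E}_q\bigl[d_H(\widehat g,g^\star)\bigr]\ \ge\ c\,N^{-\frac{1+\alpha}{2(1+\alpha)+d}},$$ where $\mathbb{E}_q$ is the expectation under $N$ i.i.d. copies of $(X_0,X_T)\sim\rho_0(x)\,q(0,x;T,z)\,dx\,dz$ and the infimum is over all estimators $\widehat g$, that is, all jointly measurable functions of the sample and of $z$ (which may depend on $\rho_0,\rho_T,N$ and all the constants, but not on $q$). -/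

import Mathlib

open MeasureTheory Set
open scoped ENNReal NNReal

noncomputable section

namespace SchrodingerBridge

/-- The unit cube `[0,1]^d` in `ℝ^d`. As `ℝ^d` is modelled by `Fin d → ℝ`, `‖·‖` on it is the max-norm
and `volume` is Lebesgue measure. -/
def cube (d : ℕ) : Set (Fin d → ℝ) := Icc 0 1

/-- The `i`-th partial derivative of `f` at `x`. -/
def partialDeriv {d : ℕ} (i : Fin d) (f : (Fin d → ℝ) → ℝ) (x : Fin d → ℝ) : ℝ :=
  fderiv ℝ f x (Pi.single i 1)

/-- The supremum norm over `U`. -/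
def supNormOn {d : ℕ} (U : Set (Fin d → ℝ)) (f : (Fin d → ℝ) → ℝ) : ℝ≥0∞ :=
  ⨆ x ∈ U, ENNReal.ofReal |f x|

/-- The Hölder seminorm `[f]_{α,U} = sup_{x ≠ y ∈ U} |f x - f y| / |x - y|^α`. -/
def holderSeminormOn {d : ℕ} (α : ℝ) (U : Set (Fin d → ℝ)) (f : (Fin d → ℝ) → ℝ) : ℝ≥0∞ :=
  ⨆ x ∈ U, ⨆ y ∈ U, ⨆ _ : x ≠ y, ENNReal.ofReal (|f x - f y| / ‖x - y‖ ^ α)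

/-- The norm of `H^{1,α}(closure U)`, for `U` open and bounded: the largest of the supremum norms of
`f` and its first partial derivatives and of the Hölder seminorms of these derivatives. -/
def holderOneNorm {d : ℕ} (α : ℝ) (U : Set (Fin d → ℝ)) (f : (Fin d → ℝ) → ℝ) : ℝ≥0∞ :=
  max (max (supNormOn U f) (⨆ i, supNormOn U (partialDeriv i f)))
    (⨆ i, holderSeminormOn α U (partialDeriv i f))

/-- Membership in `H^{1,α}(closure U)`, for `U` open and bounded: `f` is `C¹` in `U`, it is uniformly
continuous together with its partial derivatives, and the partial derivatives are uniformly
`α`-Hölder continuous in `U`. -/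
def MemHolderOne {d : ℕ} (α : ℝ) (U : Set (Fin d → ℝ)) (f : (Fin d → ℝ) → ℝ) : Prop :=
  ContDiffOn ℝ 1 f U ∧ UniformContinuousOn f U ∧
    (∀ i, UniformContinuousOn (partialDeriv i f) U) ∧
    ∀ i, holderSeminormOn α U (partialDeriv i f) < ⊤

/-- `ρ` is a probability density with support `[0,1]^d` and `ρmin ≤ ρ ≤ ρmax` there. -/
structure IsCubeDensity {d : ℕ} (ρmin ρmax : ℝ) (ρ : (Fin d → ℝ) → ℝ) : Prop where
  measurable : Measurable ρ
  bounds : ∀ x ∈ cube d, ρmin ≤ ρ x ∧ ρ x ≤ ρmax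
  eq_zero : ∀ x, x ∉ cube d → ρ x = 0
  integral_eq_one : ∫ x in cube d, ρ x = 1

/-- `q x z` stands for `q(0,x;T,z)`: a continuous, strictly positive transition density on
`ℝ^d × ℝ^d`. -/
structure IsTransitionDensity {d : ℕ} (q : (Fin d → ℝ) → (Fin d → ℝ) → ℝ) : Prop where
  continuous : Continuous (Function.uncurry q)
  pos : ∀ x z, 0 < q x z
  integrable : ∀ x, Integrable (q x)
  integral_eq_one : ∀ x, ∫ z, q x z = 1

/-- The class `Q_α(qmin, qmax)` of transition densities, with the Hölder bound `B` on
`q(0,·;T,z) ρ₀(·)`, uniformly in `z ∈ [0,1]^d`. -/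
structure InClass {d : ℕ} (α qmin qmax B : ℝ) (ρ₀ : (Fin d → ℝ) → ℝ)
    (q : (Fin d → ℝ) → (Fin d → ℝ) → ℝ) : Prop where
  transition : IsTransitionDensity q
  bounds : ∀ x ∈ cube d, ∀ z ∈ cube d, qmin ≤ q x z ∧ q x z ≤ qmax
  memHolder : ∀ z ∈ cube d, MemHolderOne α (interior (cube d)) (fun x => q x z * ρ₀ x)
  holder_le : ∀ z ∈ cube d,
    holderOneNorm α (interior (cube d)) (fun x => q x z * ρ₀ x) ≤ ENNReal.ofReal B

/-- The operator `C[g](z) = ∫ ρ₀(x) / (∫ q(0,x;T,z') ρ_T(z') / g(z') dz') q(0,x;T,z) dx`. -/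
def schrodingerOp {d : ℕ} (ρ₀ ρT : (Fin d → ℝ) → ℝ) (q : (Fin d → ℝ) → (Fin d → ℝ) → ℝ)
    (g : (Fin d → ℝ) → ℝ) (z : Fin d → ℝ) : ℝ :=
  ∫ x in cube d, ρ₀ x / (∫ z' in cube d, q x z' * (ρT z' / g z')) * q x z

/-- `g` is the Schrödinger fixed point `g*` of `q`: the (unique) continuous, strictly positive
solution of `C[g] = g` on `[0,1]^d` with `∫ g = 1`. -/
structure IsFixedPoint {d : ℕ} (ρ₀ ρT : (Fin d → ℝ) → ℝ) (q : (Fin d → ℝ) → (Fin d → ℝ) → ℝ)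
    (g : (Fin d → ℝ) → ℝ) : Prop where
  continuousOn : ContinuousOn g (cube d)
  pos : ∀ z ∈ cube d, 0 < g z
  integral_eq_one : ∫ z in cube d, g z = 1
  fixed : ∀ z ∈ cube d, schrodingerOp ρ₀ ρT q g z = g z

/-- `M(f,g) = inf {l > 0 : f ≤ l g a.e. on S}`, with `inf ∅ = ∞`. -/
def hilbertM {d : ℕ} (S : Set (Fin d → ℝ)) (f g : (Fin d → ℝ) → ℝ) : ℝ≥0∞ :=
  ⨅ l : ℝ≥0, ⨅ _ : 0 < l ∧ ∀ᵐ z ∂(volume.restrict S), f z ≤ l * g z, (l : ℝ≥0∞)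

/-- `m(f,g) = sup {l > 0 : l g ≤ f a.e. on S}`, with `sup ∅ = 0`. -/
def hilbertm {d : ℕ} (S : Set (Fin d → ℝ)) (f g : (Fin d → ℝ) → ℝ) : ℝ≥0∞ :=
  ⨆ l : ℝ≥0, ⨆ _ : 0 < l ∧ ∀ᵐ z ∂(volume.restrict S), l * g z ≤ f z, (l : ℝ≥0∞)

open Classical in
/-- The Hilbert metric `d_H(f,g) = log (M(f,g) / m(f,g))` on `S`, with value `∞` if `m(f,g) = 0` or
`M(f,g) = ∞`. -/
def hilbertDist {d : ℕ} (S : Set (Fin d → ℝ)) (f g : (Fin d → ℝ) → ℝ) : ℝ≥0∞ :=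
  if hilbertm S f g = 0 ∨ hilbertM S f g = ⊤ then ⊤
  else ENNReal.ofReal (Real.log (hilbertM S f g / hilbertm S f g).toReal)

/-- The joint law of `(X_0, X_T)`, with density `ρ₀(x) q(0,x;T,z)`. -/
def jointLaw {d : ℕ} (ρ₀ : (Fin d → ℝ) → ℝ) (q : (Fin d → ℝ) → (Fin d → ℝ) → ℝ) :
    Measure ((Fin d → ℝ) × (Fin d → ℝ)) :=
  volume.withDensity (fun p => ENNReal.ofReal (ρ₀ p.1 * q p.1 p.2))

/-- The law of `N` independent copies of `(X_0, X_T)`. -/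
def sampleLaw {d : ℕ} (N : ℕ) (ρ₀ : (Fin d → ℝ) → ℝ) (q : (Fin d → ℝ) → (Fin d → ℝ) → ℝ) :
    Measure (Fin N → (Fin d → ℝ) × (Fin d → ℝ)) :=
  Measure.pi (fun _ => jointLaw ρ₀ q)

/-- The minimax risk `inf_ĝ sup_q E_q[d_H(ĝ, g*)]`. An estimator is a function of the `N` observations
and of `z`, jointly measurable; it may use everything but `q`. It is compared with the fixed point
`g*` of `q`. -/
def minimaxRisk {d : ℕ} (N : ℕ) (α qmin qmax B : ℝ) (ρ₀ ρT : (Fin d → ℝ) → ℝ) : ℝ≥0∞ :=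
  ⨅ (ghat : (Fin N → (Fin d → ℝ) × (Fin d → ℝ)) → (Fin d → ℝ) → ℝ)
    (_ : Measurable (Function.uncurry ghat)),
  ⨆ (q : (Fin d → ℝ) → (Fin d → ℝ) → ℝ) (_ : InClass α qmin qmax B ρ₀ q)
    (g : (Fin d → ℝ) → ℝ) (_ : IsFixedPoint ρ₀ ρT q g),
  ∫⁻ ω, hilbertDist (cube d) (ghat ω) g ∂(sampleLaw N ρ₀ q)

end SchrodingerBridge

end

/-!
The class of transition densities restricts `q` through a Hölder bound in the starting point `x`
only; in the terminal point `z` it asks for mere continuity, and the fixed point inherits its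
dependence on `z` from `q`. Two members of the class can therefore differ by a fixed factor on a
ball in `z` so small that a sample of size `N` misses it with probability at least `1 / 2`. This
gives a lower bound for the minimax risk that does not depend on `N` at all, namely
`log √(qlow / qmin) / 4`, and `N ^ (-(1 + α) / (2 (1 + α) + d)) ≤ 1` yields the rate.

The two hypotheses have to be members of the class for which the fixed point exists. They are
built so that it is explicit: if `q x z = w x * r z` for `z` in the cube, then
`g = r / ∫ r` solves the Schrödinger system, whatever `ρ₀` and `ρT` are (`IsSplitting.isFixedPoint`).
* The factor `w` has to satisfy the Hölder bound jointly with `ρ₀`, about which nothing is known but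
  that the class with `qlow` has a member `q`. The mean of `q(·, z)` over `z` in the cube is less
  than `1`, as `q` puts mass outside the cube, and it is approximated uniformly by convex
  combinations of sections `q(·, z)`, which keep all convex constraints
  (`InClass.exists_average`). Such a combination serves as `w`; the missing mass is put outside the
  cube (`splitDensity`).
* The factor `r` is `1` for one hypothesis; for the other it has a dip down to `qmin / qlow` on a
  ball of radius of order `1 / N`. The bound `qlow ≤ w` leaves exactly this room above `qmin`.

The mass removed by the dip moves out of the cube, so off the ball the second law dominates the
first, and no test can separate the two unless an observation hits the ball
(`one_le_testing_errors`). An estimator gives rise to a test: its averages over the dip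
and over the rest of the cube are compared, and on either outcome it is at Hilbert distance at least
`log √(qlow / qmin)` from one of the two fixed points (`log_le_hilbertDist_of_averages`). Averages
are measurable functions of the sample, which spares a proof that the Hilbert distance is one.
-/

namespace SchrodingerBridge

/-! ### Hölder classes -/

lemma holderOneNorm_le_iff {d : ℕ} {α : ℝ} {U : Set (Fin d → ℝ)} {f : (Fin d → ℝ) → ℝ} {C : ℝ≥0∞} :
    holderOneNorm α U f ≤ C ↔ (∀ x ∈ U, ENNReal.ofReal |f x| ≤ C) ∧
      (∀ i, ∀ x ∈ U, ENNReal.ofReal |partialDeriv i f x| ≤ C) ∧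
      ∀ i, ∀ x ∈ U, ∀ y ∈ U, x ≠ y →
        ENNReal.ofReal (|partialDeriv i f x - partialDeriv i f y| / ‖x - y‖ ^ α) ≤ C := by
  simp only [holderOneNorm, supNormOn, holderSeminormOn, max_le_iff, iSup_le_iff, and_assoc]

lemma ofReal_abs_comb_le {a b u v : ℝ} {C : ℝ≥0∞} (ha : 0 ≤ a) (hb : 0 ≤ b) (hab : a + b ≤ 1)
    (hu : ENNReal.ofReal |u| ≤ C) (hv : ENNReal.ofReal |v| ≤ C) :
    ENNReal.ofReal |a * u + b * v| ≤ C := by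
  calc ENNReal.ofReal |a * u + b * v| ≤ ENNReal.ofReal (a * |u| + b * |v|) := by
        refine ENNReal.ofReal_le_ofReal ((abs_add_le _ _).trans_eq ?_)
        rw [abs_mul, abs_mul, abs_of_nonneg ha, abs_of_nonneg hb]
    _ = ENNReal.ofReal a * ENNReal.ofReal |u| + ENNReal.ofReal b * ENNReal.ofReal |v| := by
        rw [ENNReal.ofReal_add (by positivity) (by positivity), ENNReal.ofReal_mul ha,
          ENNReal.ofReal_mul hb]
    _ ≤ ENNReal.ofReal a * C + ENNReal.ofReal b * C := by gcongr
    _ = ENNReal.ofReal (a + b) * C := by rw [ENNReal.ofReal_add ha hb, add_mul]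
    _ ≤ 1 * C := by
        gcongr
        exact ENNReal.ofReal_le_one.2 hab
    _ = C := one_mul C

lemma partialDeriv_congr {d : ℕ} {U : Set (Fin d → ℝ)} (hU : IsOpen U) {f g : (Fin d → ℝ) → ℝ}
    (h : EqOn f g U) (i : Fin d) : EqOn (partialDeriv i f) (partialDeriv i g) U := by
  intro x hx
  simp only [partialDeriv]
  rw [(h.eventuallyEq_of_mem (hU.mem_nhds hx)).fderiv_eq]

/-- `f` lies in the ball of radius `C` of `H^{1,α}(closure U)`. -/
def InHolderBall {d : ℕ} (α : ℝ) (U : Set (Fin d → ℝ)) (C : ℝ≥0∞) (f : (Fin d → ℝ) → ℝ) : Prop :=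
  MemHolderOne α U f ∧ holderOneNorm α U f ≤ C

lemma InHolderBall.congr {d : ℕ} {α : ℝ} {U : Set (Fin d → ℝ)} {C : ℝ≥0∞}
    {f g : (Fin d → ℝ) → ℝ} (hf : InHolderBall α U C f) (hU : IsOpen U) (h : EqOn g f U) :
    InHolderBall α U C g := by
  obtain ⟨⟨h1, h2, h3, h4⟩, h5⟩ := hf
  have hp := fun i => partialDeriv_congr hU h i
  refine ⟨⟨h1.congr h, h2.congr h.symm,
    fun i => (h3 i).congr (hp i).symm, fun i => ?_⟩, ?_⟩
  · refine lt_of_le_of_lt ?_ (h4 i)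
    simp only [holderSeminormOn]
    refine iSup₂_mono fun x hx => iSup₂_mono fun y hy => ?_
    rw [hp i hx, hp i hy]
  · rw [holderOneNorm_le_iff] at h5 ⊢
    obtain ⟨a, b, c⟩ := h5
    refine ⟨fun x hx => ?_, fun i x hx => ?_, fun i x hx y hy hxy => ?_⟩
    · rw [h hx]; exact a x hx
    · rw [hp i hx]; exact b i x hx
    · rw [hp i hx, hp i hy]; exact c i x hx y hy hxy

lemma InHolderBall.comb {d : ℕ} {α : ℝ} {U : Set (Fin d → ℝ)} {C : ℝ≥0∞}
    {f g : (Fin d → ℝ) → ℝ} (hf : InHolderBall α U C f) (hg : InHolderBall α U C g)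
    (hU : IsOpen U) (hC : C ≠ ⊤) {a b : ℝ} (ha : 0 ≤ a) (hb : 0 ≤ b) (hab : a + b ≤ 1) :
    InHolderBall α U C (fun x => a * f x + b * g x) := by
  obtain ⟨⟨h1, h2, h3, h4⟩, h5⟩ := hf
  obtain ⟨⟨k1, k2, k3, k4⟩, k5⟩ := hg
  have hp : ∀ i, EqOn (partialDeriv i (fun x => a * f x + b * g x))
      (fun x => a * partialDeriv i f x + b * partialDeriv i g x) U := by
    intro i x hx
    have hfx : DifferentiableAt ℝ f x :=
      (h1.differentiableOn one_ne_zero x hx).differentiableAt (hU.mem_nhds hx)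
    have hgx : DifferentiableAt ℝ g x :=
      (k1.differentiableOn one_ne_zero x hx).differentiableAt (hU.mem_nhds hx)
    simp only [partialDeriv]
    rw [fderiv_fun_add (hfx.const_mul a) (hgx.const_mul b), fderiv_const_mul hfx,
      fderiv_const_mul hgx]
    simp
  have uc : ∀ {u v : (Fin d → ℝ) → ℝ}, UniformContinuousOn u U → UniformContinuousOn v U →
      UniformContinuousOn (fun x => a * u x + b * v x) U := by
    intro u v hu hv
    rw [uniformContinuousOn_iff_restrict] at hu hv ⊢
    exact (hu.const_mul' a).add (hv.const_mul' b)
  have key : holderOneNorm α U (fun x => a * f x + b * g x) ≤ C := by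
    rw [holderOneNorm_le_iff] at h5 k5 ⊢
    obtain ⟨f1, f2, f3⟩ := h5
    obtain ⟨g1, g2, g3⟩ := k5
    refine ⟨fun x hx => ofReal_abs_comb_le ha hb hab (f1 x hx) (g1 x hx), fun i x hx => ?_,
      fun i x hx y hy hxy => ?_⟩
    · rw [hp i hx]
      exact ofReal_abs_comb_le ha hb hab (f2 i x hx) (g2 i x hx)
    · have ht : 0 ≤ ‖x - y‖ ^ α := by positivity
      have habs : ∀ u : ℝ, |u| / ‖x - y‖ ^ α = |u / ‖x - y‖ ^ α| := fun u => by
        rw [abs_div, abs_of_nonneg ht]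
      have f3' := f3 i x hx y hy hxy
      have g3' := g3 i x hx y hy hxy
      rw [habs] at f3' g3' ⊢
      rw [hp i hx, hp i hy]
      convert ofReal_abs_comb_le ha hb hab f3' g3' using 3
      ring
  refine ⟨⟨(contDiffOn_const.mul h1).add (contDiffOn_const.mul k1), uc h2 k2,
    fun i => (uc (h3 i) (k3 i)).congr (hp i).symm, fun i => ?_⟩, key⟩
  refine lt_of_le_of_lt ?_ (lt_of_le_of_lt key hC.lt_top)
  exact (le_iSup (fun i => holderSeminormOn α U (partialDeriv i _)) i).trans (le_max_right _ _)

/-! ### An average of the transition density over the terminal point -/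

/-- The coordinatewise projection of `ℝ^d` onto the unit cube. -/
def clamp {d : ℕ} (x : Fin d → ℝ) : Fin d → ℝ := fun i => max 0 (min (x i) 1)

lemma continuous_clamp {d : ℕ} : Continuous (clamp (d := d)) := by
  unfold clamp; fun_prop

lemma clamp_mem {d : ℕ} (x : Fin d → ℝ) : clamp x ∈ cube d :=
  ⟨fun _ => le_max_left _ _, fun _ => max_le zero_le_one (min_le_right _ _)⟩

lemma clamp_eq {d : ℕ} {x : Fin d → ℝ} (hx : x ∈ cube d) : clamp x = x := by
  funext i
  exact (congrArg (max 0) (min_eq_left (hx.2 i))).trans (max_eq_right (hx.1 i))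

lemma isCompact_cube (d : ℕ) : IsCompact (cube d) := isCompact_Icc

lemma measurableSet_cube (d : ℕ) : MeasurableSet (cube d) := measurableSet_Icc

lemma volume_cube (d : ℕ) : volume (cube d) = 1 := by
  simp [cube, Real.volume_Icc_pi]

instance isProbabilityMeasure_cube (d : ℕ) : IsProbabilityMeasure (volume.restrict (cube d)) :=
  ⟨by simp [volume_cube]⟩

lemma compl_cube_nonempty {d : ℕ} (hd : 1 ≤ d) : (cube d)ᶜ.Nonempty := by
  refine ⟨fun _ => 2, fun h => ?_⟩
  have := h.2 ⟨0, hd⟩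
  norm_num at this

lemma volume_pos_compl_cube {d : ℕ} (hd : 1 ≤ d) : 0 < volume (cube d)ᶜ :=
  (isCompact_cube d).isClosed.isOpen_compl.measure_pos _ (compl_cube_nonempty hd)

/-- Mass escapes from the cube because the transition density is positive outside it. -/
lemma IsTransitionDensity.setIntegral_cube_lt_one {d : ℕ} (hd : 1 ≤ d)
    {q : (Fin d → ℝ) → (Fin d → ℝ) → ℝ} (hq : IsTransitionDensity q) (x : Fin d → ℝ) :
    ∫ z in cube d, q x z < 1 := by
  have h1 := integral_add_compl (measurableSet_cube d) (hq.integrable x)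
  rw [hq.integral_eq_one] at h1
  have h2 : 0 < ∫ z in (cube d)ᶜ, q x z := by
    rw [setIntegral_pos_iff_support_of_nonneg_ae
      (Filter.Eventually.of_forall fun z => (hq.pos x z).le) (hq.integrable x).integrableOn]
    have : Function.support (q x) = univ := by
      ext z; simp [(hq.pos x z).ne']
    rw [this, univ_inter]
    exact volume_pos_compl_cube hd
  linarith

/-- A member of the closed convex hull of the sections `q(·, z)` is close to their mean over the
cube; it keeps their bounds and their Hölder bound, and it is bounded away from `1` because the mean
`∫ q(x, z) dz` over the cube is. -/
lemma InClass.exists_average {d : ℕ} (hd : 1 ≤ d) {α qlow qmax B : ℝ} {ρ₀ : (Fin d → ℝ) → ℝ}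
    {q : (Fin d → ℝ) → (Fin d → ℝ) → ℝ} (hq : InClass α qlow qmax B ρ₀ q) :
    ∃ w : (Fin d → ℝ) → ℝ, Continuous w ∧ (∀ x, qlow ≤ w x ∧ w x ≤ qmax) ∧
      (∃ η > 0, ∀ x, w x ≤ 1 - η) ∧
      InHolderBall α (interior (cube d)) (ENNReal.ofReal B) (fun x => w x * ρ₀ x) := by
  have : CompactSpace (cube d) := isCompact_iff_compactSpace.1 (isCompact_cube d)
  have : Nonempty (cube d) := ⟨⟨_, clamp_mem 0⟩⟩
  let ext (f : C(cube d, ℝ)) (x : Fin d → ℝ) : ℝ := f ⟨clamp x, clamp_mem x⟩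
  have ext_cont : ∀ f, Continuous (ext f) := fun f =>
    f.continuous.comp (continuous_clamp.subtype_mk _)
  let K : Set C(cube d, ℝ) := {f | (∀ x, qlow ≤ f x ∧ f x ≤ qmax) ∧
    InHolderBall α (interior (cube d)) (ENNReal.ofReal B) (fun x => ext f x * ρ₀ x)}
  have hK : Convex ℝ K := by
    rintro f ⟨hf1, hf2⟩ g ⟨hg1, hg2⟩ a b ha hb hab
    refine ⟨fun x => ?_, ?_⟩
    · obtain ⟨h1, h2⟩ := hf1 x
      obtain ⟨h3, h4⟩ := hg1 x
      have hb' : b = 1 - a := by linarith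
      simp only [ContinuousMap.add_apply, ContinuousMap.smul_apply, smul_eq_mul]
      subst hb'
      constructor <;> nlinarith
    · convert hf2.comb hg2 isOpen_interior ENNReal.ofReal_ne_top ha hb hab.le using 2
      simp only [ext, ContinuousMap.add_apply, ContinuousMap.smul_apply, smul_eq_mul]
      ring
  let Q : C((Fin d → ℝ) × cube d, ℝ) :=
    ⟨fun p => q p.2 p.1, hq.transition.continuous.comp (by fun_prop :
      Continuous fun p : (Fin d → ℝ) × cube d => ((p.2 : Fin d → ℝ), p.1))⟩
  let F : C(Fin d → ℝ, C(cube d, ℝ)) := Q.curry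
  have hF : ∀ z x, F z x = q x z := fun _ _ => rfl
  have hFK : ∀ z ∈ cube d, F z ∈ K := by
    intro z hz
    refine ⟨fun x => hq.bounds x x.2 z hz, ?_⟩
    have : InHolderBall α (interior (cube d)) (ENNReal.ofReal B) (fun x => q x z * ρ₀ x) :=
      ⟨hq.memHolder z hz, hq.holder_le z hz⟩
    refine this.congr isOpen_interior fun x hx => ?_
    simp only [ext, hF, clamp_eq (interior_subset hx)]
  have hFint : Integrable F (volume.restrict (cube d)) :=
    F.continuous.continuousOn.integrableOn_compact (isCompact_cube d)
  have hmem : ∫ z in cube d, F z ∈ closure K :=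
    hK.closure.integral_mem isClosed_closure
      ((ae_restrict_iff' (measurableSet_cube d)).2
        (Filter.Eventually.of_forall fun z hz => subset_closure (hFK z hz))) hFint
  set m : C(cube d, ℝ) := ∫ z in cube d, F z with hm
  have hm_apply : ∀ x, m x = ∫ z in cube d, q x z := fun x => by
    rw [hm, ContinuousMap.integral_apply hFint]
    rfl
  obtain ⟨x₀, -, hx₀⟩ := isCompact_univ.exists_isMaxOn univ_nonempty m.continuous.continuousOn
  have hlt : m x₀ < 1 := by
    rw [hm_apply]
    exact hq.transition.setIntegral_cube_lt_one hd _
  obtain ⟨f, hfK, hf⟩ := Metric.mem_closure_iff.1 hmem ((1 - m x₀) / 2) (by linarith)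
  refine ⟨ext f, ext_cont f, fun x => hfK.1 _, ⟨(1 - m x₀) / 2, by linarith, fun x => ?_⟩, hfK.2⟩
  have h1 := (ContinuousMap.dist_apply_le_dist (f := m) (g := f) ⟨clamp x, clamp_mem x⟩).trans hf.le
  rw [Real.dist_eq, abs_le] at h1
  have h2 : m ⟨clamp x, clamp_mem x⟩ ≤ m x₀ := hx₀ (mem_univ _)
  simp only [ext]
  linarith [h1.1]

/-! ### Transition densities that split on the cube -/

/-- Ingredients of a transition density which on the cube is a function of the starting point times
a function of the terminal point: the factor `w` of the starting point, a cutoff `τ` of the cube and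
a probability density `ψ` that lives on the complement of the cube and receives the mass that is
missing on the cube. -/
structure IsSplitting {d : ℕ} (w τ ψ : (Fin d → ℝ) → ℝ) : Prop where
  w_continuous : Continuous w
  w_pos : ∀ x, 0 < w x
  τ_continuous : Continuous τ
  τ_nonneg : ∀ z, 0 ≤ τ z
  τ_integrable : Integrable τ
  τ_eq_one : ∀ z ∈ cube d, τ z = 1
  mass_lt_one : ∀ x, w x * ∫ z, τ z < 1
  ψ_continuous : Continuous ψ
  ψ_nonneg : ∀ z, 0 ≤ ψ z
  ψ_integrable : Integrable ψ
  ψ_eq_zero : ∀ z ∈ cube d, ψ z = 0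
  ψ_pos : ∀ z, z ∉ cube d → 0 < ψ z
  ψ_integral : ∫ z, ψ z = 1

/-- The transition density that equals `w x * r z` for `z` in the cube. -/
noncomputable def splitDensity {d : ℕ} (w τ ψ r : (Fin d → ℝ) → ℝ) (x z : Fin d → ℝ) : ℝ :=
  w x * (r z * τ z) + (1 - w x * ∫ y, r y * τ y) * ψ z

lemma exists_cutoff (d : ℕ) {η : ℝ} (hη : 0 < η) :
    ∃ τ : (Fin d → ℝ) → ℝ, Continuous τ ∧ (∀ z, 0 ≤ τ z) ∧ Integrable τ ∧
      (∀ z ∈ cube d, τ z = 1) ∧ ∫ z, τ z < 1 + η := by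
  have h := (isCompact_cube d).measure_eq_biInf_integral_hasCompactSupport volume
  have hlt : volume (cube d) < ENNReal.ofReal (1 + η) := by
    rw [volume_cube]
    exact ENNReal.one_lt_ofReal.2 (by linarith)
  rw [h] at hlt
  simp only [iInf_lt_iff] at hlt
  obtain ⟨τ, h1, h2, h3, h4, h5⟩ := hlt
  exact ⟨τ, h1, h4, h1.integrable_of_hasCompactSupport h2, fun z hz => h3 hz,
    (ENNReal.ofReal_lt_ofReal_iff (by linarith)).1 h5⟩

lemma IsTransitionDensity.exists_tail {d : ℕ} (hd : 1 ≤ d)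
    {q : (Fin d → ℝ) → (Fin d → ℝ) → ℝ} (hq : IsTransitionDensity q) :
    ∃ ψ : (Fin d → ℝ) → ℝ, Continuous ψ ∧ (∀ z, 0 ≤ ψ z) ∧ Integrable ψ ∧
      (∀ z ∈ cube d, ψ z = 0) ∧ (∀ z, z ∉ cube d → 0 < ψ z) ∧ ∫ z, ψ z = 1 := by
  have hne : (cube d).Nonempty := ⟨_, clamp_mem 0⟩
  let φ (z : Fin d → ℝ) : ℝ := min 1 (Metric.infDist z (cube d)) * q 0 z
  have hmin : Continuous fun z : Fin d → ℝ => min 1 (Metric.infDist z (cube d)) :=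
    continuous_const.min (Metric.continuous_infDist_pt _)
  have hcont : Continuous φ := hmin.mul (hq.continuous.comp (by fun_prop :
    Continuous fun z : Fin d → ℝ => ((0 : Fin d → ℝ), z)))
  have hmin0 : ∀ z, 0 ≤ min 1 (Metric.infDist z (cube d)) := fun z =>
    le_min zero_le_one Metric.infDist_nonneg
  have hnonneg : ∀ z, 0 ≤ φ z := fun z => mul_nonneg (hmin0 z) (hq.pos 0 z).le
  have hpos : ∀ z, z ∉ cube d → 0 < φ z := fun z hz =>
    mul_pos (lt_min one_pos (((isCompact_cube d).isClosed.notMem_iff_infDist_pos hne).1 hz))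
      (hq.pos 0 z)
  have hint : Integrable φ := by
    refine (hq.integrable 0).mono' hcont.aestronglyMeasurable
      (Filter.Eventually.of_forall fun z => ?_)
    rw [Real.norm_of_nonneg (hnonneg z)]
    exact mul_le_of_le_one_left (hq.pos 0 z).le (min_le_left _ _)
  have hI : 0 < ∫ z, φ z := by
    rw [integral_pos_iff_support_of_nonneg hnonneg hint]
    exact (volume_pos_compl_cube hd).trans_le (measure_mono fun z hz => (hpos z hz).ne')
  refine ⟨fun z => φ z / ∫ y, φ y, hcont.div_const _, fun z => div_nonneg (hnonneg z) hI.le,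
    hint.div_const _, fun z hz => ?_, fun z hz => div_pos (hpos z hz) hI, ?_⟩
  · simp [φ, Metric.infDist_zero_of_mem hz]
  · rw [integral_div, div_self hI.ne']

namespace IsSplitting

variable {d : ℕ} {w τ ψ r r' : (Fin d → ℝ) → ℝ}

lemma eq_on_cube (h : IsSplitting w τ ψ) (r : (Fin d → ℝ) → ℝ) (x : Fin d → ℝ) {z : Fin d → ℝ}
    (hz : z ∈ cube d) : splitDensity w τ ψ r x z = w x * r z := by
  simp [splitDensity, h.τ_eq_one z hz, h.ψ_eq_zero z hz]

lemma integrable_mul (h : IsSplitting w τ ψ) (hr : Continuous r) (hr0 : ∀ z, 0 < r z)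
    (hr1 : ∀ z, r z ≤ 1) : Integrable fun z => r z * τ z := by
  refine h.τ_integrable.mono' (hr.mul h.τ_continuous).aestronglyMeasurable
    (Filter.Eventually.of_forall fun z => ?_)
  rw [Real.norm_of_nonneg (mul_nonneg (hr0 z).le (h.τ_nonneg z))]
  exact mul_le_of_le_one_left (h.τ_nonneg z) (hr1 z)

lemma mass_mul_lt_one (h : IsSplitting w τ ψ) (hr : Continuous r) (hr0 : ∀ z, 0 < r z)
    (hr1 : ∀ z, r z ≤ 1) (x : Fin d → ℝ) : w x * ∫ z, r z * τ z < 1 := by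
  refine lt_of_le_of_lt ?_ (h.mass_lt_one x)
  refine mul_le_mul_of_nonneg_left ?_ (h.w_pos x).le
  exact integral_mono (h.integrable_mul hr hr0 hr1) h.τ_integrable fun z =>
    mul_le_of_le_one_left (h.τ_nonneg z) (hr1 z)

lemma isTransitionDensity (h : IsSplitting w τ ψ) (hr : Continuous r) (hr0 : ∀ z, 0 < r z)
    (hr1 : ∀ z, r z ≤ 1) : IsTransitionDensity (splitDensity w τ ψ r) where
  continuous := by
    have h1 := h.w_continuous
    have h2 := h.τ_continuous
    have h3 := h.ψ_continuous
    unfold Function.uncurry splitDensity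
    fun_prop
  pos x z := by
    by_cases hz : z ∈ cube d
    · rw [h.eq_on_cube r x hz]
      exact mul_pos (h.w_pos x) (hr0 z)
    · have h1 := mul_nonneg (h.w_pos x).le (mul_nonneg (hr0 z).le (h.τ_nonneg z))
      have h2 := mul_pos (sub_pos.2 (h.mass_mul_lt_one hr hr0 hr1 x)) (h.ψ_pos z hz)
      unfold splitDensity
      linarith
  integrable x := ((h.integrable_mul hr hr0 hr1).const_mul _).add (h.ψ_integrable.const_mul _)
  integral_eq_one x := by
    unfold splitDensity
    rw [integral_add ((h.integrable_mul hr hr0 hr1).const_mul _) (h.ψ_integrable.const_mul _),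
      integral_const_mul, integral_const_mul, h.ψ_integral]
    ring

lemma inClass (h : IsSplitting w τ ψ) (hr : Continuous r) (hr0 : ∀ z, 0 < r z)
    (hr1 : ∀ z, r z ≤ 1) {α qmin qlow qmax B : ℝ} {ρ₀ : (Fin d → ℝ) → ℝ}
    (hrmin : ∀ z, qmin ≤ qlow * r z) (hw : ∀ x, qlow ≤ w x ∧ w x ≤ qmax)
    (hB : InHolderBall α (interior (cube d)) (ENNReal.ofReal B) (fun x => w x * ρ₀ x)) :
    InClass α qmin qmax B ρ₀ (splitDensity w τ ψ r) := by
  have hball : ∀ z ∈ cube d, InHolderBall α (interior (cube d)) (ENNReal.ofReal B)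
      (fun x => splitDensity w τ ψ r x z * ρ₀ x) := by
    intro z hz
    convert hB.comb hB isOpen_interior ENNReal.ofReal_ne_top (hr0 z).le le_rfl
      (by linarith [hr1 z]) using 2 with x
    rw [h.eq_on_cube r x hz]
    ring
  refine ⟨h.isTransitionDensity hr hr0 hr1, fun x _ z hz => ?_, fun z hz => (hball z hz).1,
    fun z hz => (hball z hz).2⟩
  rw [h.eq_on_cube r x hz]
  exact ⟨(hrmin z).trans (mul_le_mul_of_nonneg_right (hw x).1 (hr0 z).le),
    (mul_le_of_le_one_right (h.w_pos x).le (hr1 z)).trans (hw x).2⟩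

lemma setIntegral_pos (hr : Continuous r) (hr0 : ∀ z, 0 < r z) : 0 < ∫ z in cube d, r z := by
  rw [setIntegral_pos_iff_support_of_nonneg_ae (Filter.Eventually.of_forall fun z => (hr0 z).le)
    (hr.continuousOn.integrableOn_compact (isCompact_cube d))]
  have : Function.support r = univ := by
    ext z; simp [(hr0 z).ne']
  rw [this, univ_inter, volume_cube]
  exact one_pos

/-- For a transition density that splits on the cube the Schrödinger system is solved by the
normalised factor of the terminal point. -/
lemma isFixedPoint (h : IsSplitting w τ ψ) (hr : Continuous r) (hr0 : ∀ z, 0 < r z)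
    {ρmin ρmax : ℝ} {ρ₀ ρT : (Fin d → ℝ) → ℝ} (h₀ : IsCubeDensity ρmin ρmax ρ₀)
    (hT : IsCubeDensity ρmin ρmax ρT) :
    IsFixedPoint ρ₀ ρT (splitDensity w τ ψ r) (fun z => r z / ∫ y in cube d, r y) := by
  have hI := setIntegral_pos hr hr0
  set I := ∫ y in cube d, r y with hIdef
  refine ⟨(hr.div_const _).continuousOn, fun z _ => div_pos (hr0 z) hI, ?_, fun z hz => ?_⟩
  · rw [integral_div, div_self hI.ne']
  · have inner : ∀ x, ∫ z' in cube d, splitDensity w τ ψ r x z' * (ρT z' / (r z' / I))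
        = w x * I := by
      intro x
      have : ∀ z' ∈ cube d, splitDensity w τ ψ r x z' * (ρT z' / (r z' / I))
          = w x * I * ρT z' := by
        intro z' hz'
        have := (hr0 z').ne'
        have := hI.ne'
        rw [h.eq_on_cube r x hz']
        field_simp
      rw [setIntegral_congr_fun (measurableSet_cube d) this, integral_const_mul,
        hT.integral_eq_one, mul_one]
    have outer : ∀ x ∈ cube d, ρ₀ x / (∫ z' in cube d, splitDensity w τ ψ r x z' *
        (ρT z' / (r z' / I))) * splitDensity w τ ψ r x z = r z / I * ρ₀ x := by
      intro x _
      have := (h.w_pos x).ne'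
      have := hI.ne'
      rw [inner, h.eq_on_cube r x hz]
      field_simp
    rw [schrodingerOp, setIntegral_congr_fun (measurableSet_cube d) outer, integral_const_mul,
      h₀.integral_eq_one, mul_one]

/-- Lowering `r` does not lower the density where `r` is left unchanged: the mass removed elsewhere
moves out of the cube. -/
lemma splitDensity_le (h : IsSplitting w τ ψ) (hr : Continuous r) (hr0 : ∀ z, 0 < r z)
    (hr1 : ∀ z, r z ≤ 1) (hr' : Continuous r') (hr0' : ∀ z, 0 < r' z) (hle : ∀ z, r' z ≤ r z)
    (x : Fin d → ℝ) {z : Fin d → ℝ} (hz : r' z = r z) :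
    splitDensity w τ ψ r x z ≤ splitDensity w τ ψ r' x z := by
  have hI : ∫ y, r' y * τ y ≤ ∫ y, r y * τ y :=
    integral_mono (h.integrable_mul hr' hr0' fun y => (hle y).trans (hr1 y))
      (h.integrable_mul hr hr0 hr1) fun y => mul_le_mul_of_nonneg_right (hle y) (h.τ_nonneg y)
  unfold splitDensity
  rw [hz]
  have h1 := mul_le_mul_of_nonneg_left hI (h.w_pos x).le
  have h2 := h.ψ_nonneg z
  gcongr

end IsSplitting

lemma InClass.exists_isSplitting {d : ℕ} (hd : 1 ≤ d) {α qlow qmax B : ℝ} (hlow : 0 < qlow)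
    {ρ₀ : (Fin d → ℝ) → ℝ} {q : (Fin d → ℝ) → (Fin d → ℝ) → ℝ}
    (hq : InClass α qlow qmax B ρ₀ q) :
    ∃ w τ ψ : (Fin d → ℝ) → ℝ, IsSplitting w τ ψ ∧ (∀ x, qlow ≤ w x ∧ w x ≤ qmax) ∧
      InHolderBall α (interior (cube d)) (ENNReal.ofReal B) (fun x => w x * ρ₀ x) := by
  obtain ⟨w, hw1, hw2, ⟨η, hη, hw3⟩, hw4⟩ := hq.exists_average hd
  obtain ⟨τ, t1, t2, t3, t4, t5⟩ := exists_cutoff d hη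
  obtain ⟨ψ, p1, p2, p3, p4, p5, p6⟩ := hq.transition.exists_tail hd
  have hw0 : ∀ x, 0 < w x := fun x => hlow.trans_le (hw2 x).1
  refine ⟨w, τ, ψ, ⟨hw1, hw0, t1, t2, t3, t4, fun x => ?_, p1, p2, p3, p4, p5, p6⟩, hw2, hw4⟩
  have h0 : 0 ≤ ∫ z, τ z := integral_nonneg t2
  nlinarith [hw0 x, hw3 x, mul_lt_mul_of_pos_left t5 (hw0 x)]

/-! ### The testing reduction -/

lemma pi_mono_measure {ι : Type*} [Fintype ι] {X : ι → Type*} [∀ i, MeasurableSpace (X i)]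
    {μ ν : ∀ i, Measure (X i)} [∀ i, SigmaFinite (μ i)] (h : ∀ i, μ i ≤ ν i) :
    Measure.pi μ ≤ Measure.pi ν := by
  refine Measure.le_iff.2 fun s hs => ?_
  rw [Measure.pi_def (μ := ν), toMeasure_apply _ _ hs]
  refine (OuterMeasure.le_pi (n := (Measure.pi μ).toOuterMeasure)).2 (fun t _ => ?_) s
  change Measure.pi μ (univ.pi t) ≤ ∏ i, ν i (t i)
  rw [Measure.pi_pi]
  exact Finset.prod_le_prod' fun i _ => h i (t i)

/-- If `ν` dominates `μ` off a set `Eᶜ`, then a test based on `N` observations can tell `μ` from `ν`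
only when one of the observations hits `Eᶜ`. -/
lemma one_le_testing_errors {X : Type*} [MeasurableSpace X] (N : ℕ) {μ ν : Measure X}
    [IsProbabilityMeasure μ] {E : Set X} (hE : MeasurableSet E) (hle : μ.restrict E ≤ ν)
    {A : Set (Fin N → X)} (hA : MeasurableSet A) :
    1 ≤ Measure.pi (fun _ => μ) Aᶜ + Measure.pi (fun _ => ν) A + N * μ Eᶜ := by
  set P : Measure (Fin N → X) := Measure.pi fun _ => μ with hP
  set G : Set (Fin N → X) := univ.pi fun _ => E
  have h1 : P (A ∩ G) ≤ Measure.pi (fun _ => ν) A := by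
    have : P.restrict G ≤ Measure.pi fun _ => ν := by
      rw [hP, Measure.restrict_pi_pi]
      exact pi_mono_measure fun _ => hle
    calc P (A ∩ G) = P.restrict G A := (Measure.restrict_apply hA).symm
      _ ≤ _ := this A
  have h2 : P Gᶜ ≤ N * μ Eᶜ := by
    have hsub : Gᶜ ⊆ ⋃ i : Fin N, Function.eval i ⁻¹' Eᶜ := by
      intro ω hω
      simpa [G, Set.mem_pi] using hω
    calc P Gᶜ ≤ P (⋃ i : Fin N, Function.eval i ⁻¹' Eᶜ) := measure_mono hsub
      _ ≤ ∑ i : Fin N, P (Function.eval i ⁻¹' Eᶜ) := measure_iUnion_fintype_le _ _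
      _ = ∑ _i : Fin N, μ Eᶜ := by
          refine Finset.sum_congr rfl fun i _ => ?_
          exact (measurePreserving_eval (fun _ : Fin N => μ) i).measure_preimage
            hE.compl.nullMeasurableSet
      _ = N * μ Eᶜ := by simp
  calc (1 : ℝ≥0∞) = P univ := by simp [hP]
    _ ≤ P (Aᶜ ∪ A ∩ G ∪ Gᶜ) := by
        refine measure_mono fun ω _ => ?_
        by_cases ha : ω ∈ A <;> by_cases hg : ω ∈ G <;> simp [ha, hg]
    _ ≤ P Aᶜ + P (A ∩ G) + P Gᶜ :=
        (measure_union_le _ _).trans (add_le_add_left (measure_union_le _ _) _)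
    _ ≤ _ := by gcongr

lemma measurable_density {d : ℕ} {ρmin ρmax : ℝ} {ρ₀ : (Fin d → ℝ) → ℝ}
    {q : (Fin d → ℝ) → (Fin d → ℝ) → ℝ} (h₀ : IsCubeDensity ρmin ρmax ρ₀)
    (hq : IsTransitionDensity q) :
    Measurable fun p : (Fin d → ℝ) × (Fin d → ℝ) => ENNReal.ofReal (ρ₀ p.1 * q p.1 p.2) :=
  ((h₀.measurable.comp measurable_fst).mul hq.continuous.measurable).ennreal_ofReal

lemma IsCubeDensity.nonneg {d : ℕ} {ρmin ρmax : ℝ} {ρ : (Fin d → ℝ) → ℝ} (hρ : 0 < ρmin)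
    (h : IsCubeDensity ρmin ρmax ρ) (x : Fin d → ℝ) : 0 ≤ ρ x := by
  by_cases hx : x ∈ cube d
  · exact hρ.le.trans (h.bounds x hx).1
  · exact (h.eq_zero x hx).ge

lemma IsCubeDensity.lintegral_eq_one {d : ℕ} {ρmin ρmax : ℝ} {ρ : (Fin d → ℝ) → ℝ}
    (hρ : 0 < ρmin) (h : IsCubeDensity ρmin ρmax ρ) : ∫⁻ x, ENNReal.ofReal (ρ x) = 1 := by
  have hint : IntegrableOn ρ (cube d) := by
    by_contra hn
    exact zero_ne_one ((integral_undef hn).symm.trans h.integral_eq_one)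
  have h1 := ofReal_integral_eq_lintegral_ofReal hint
    (Filter.Eventually.of_forall (h.nonneg hρ))
  rw [h.integral_eq_one, ENNReal.ofReal_one] at h1
  rw [h1]
  refine (setLIntegral_eq_of_support_subset fun x hx => ?_).symm
  by_contra hn
  exact hx (by simp [h.eq_zero x hn])

lemma isProbabilityMeasure_jointLaw {d : ℕ} {ρmin ρmax : ℝ} (hρ : 0 < ρmin)
    {ρ₀ : (Fin d → ℝ) → ℝ} {q : (Fin d → ℝ) → (Fin d → ℝ) → ℝ}
    (h₀ : IsCubeDensity ρmin ρmax ρ₀) (hq : IsTransitionDensity q) :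
    IsProbabilityMeasure (jointLaw ρ₀ q) := by
  refine ⟨?_⟩
  rw [jointLaw, withDensity_apply _ MeasurableSet.univ, Measure.restrict_univ,
    Measure.volume_eq_prod, lintegral_prod _ (measurable_density h₀ hq).aemeasurable,
    ← h₀.lintegral_eq_one hρ]
  refine lintegral_congr fun x => ?_
  simp only [ENNReal.ofReal_mul (h₀.nonneg hρ x)]
  have hqx : Measurable (q x) := hq.continuous.measurable.comp measurable_prodMk_left
  rw [lintegral_const_mul _ hqx.ennreal_ofReal,
    ← ofReal_integral_eq_lintegral_ofReal (hq.integrable x)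
      (Filter.Eventually.of_forall fun z => (hq.pos x z).le), hq.integral_eq_one]
  simp

lemma jointLaw_snd_mem_le {d : ℕ} {ρmin ρmax : ℝ} (hρ : 0 < ρmin)
    {ρ₀ : (Fin d → ℝ) → ℝ} {q : (Fin d → ℝ) → (Fin d → ℝ) → ℝ}
    (h₀ : IsCubeDensity ρmin ρmax ρ₀) (hq : IsTransitionDensity q) {D : Set (Fin d → ℝ)}
    (hD : MeasurableSet D) (hle : ∀ x, ∀ z ∈ D, q x z ≤ 1) :
    jointLaw ρ₀ q (Prod.snd ⁻¹' D) ≤ volume D := by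
  have hset : (Prod.snd ⁻¹' D : Set ((Fin d → ℝ) × (Fin d → ℝ))) = univ ×ˢ D := by
    ext p; simp
  rw [jointLaw, withDensity_apply _ (measurable_snd hD), hset, Measure.volume_eq_prod,
    ← Measure.prod_restrict, lintegral_prod _ (measurable_density h₀ hq).aemeasurable,
    Measure.restrict_univ]
  calc ∫⁻ x, ∫⁻ z in D, ENNReal.ofReal (ρ₀ x * q x z)
      ≤ ∫⁻ x, ENNReal.ofReal (ρ₀ x) * volume D := by
        refine lintegral_mono fun x => ?_
        rw [← setLIntegral_const]
        refine setLIntegral_mono' hD fun z hz => ENNReal.ofReal_le_ofReal ?_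
        exact mul_le_of_le_one_right (h₀.nonneg hρ x) (hle x z hz)
    _ = volume D := by
        rw [lintegral_mul_const _ h₀.measurable.ennreal_ofReal, h₀.lintegral_eq_one hρ, one_mul]

lemma restrict_jointLaw_le {d : ℕ} {ρmin ρmax : ℝ} (hρ : 0 < ρmin)
    {ρ₀ : (Fin d → ℝ) → ℝ} {q q' : (Fin d → ℝ) → (Fin d → ℝ) → ℝ}
    (h₀ : IsCubeDensity ρmin ρmax ρ₀) {E : Set ((Fin d → ℝ) × (Fin d → ℝ))}
    (hE : MeasurableSet E) (hle : ∀ p ∈ E, q p.1 p.2 ≤ q' p.1 p.2) :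
    (jointLaw ρ₀ q).restrict E ≤ jointLaw ρ₀ q' := by
  rw [jointLaw, restrict_withDensity hE]
  calc (volume.restrict E).withDensity _
      ≤ (volume.restrict E).withDensity fun p => ENNReal.ofReal (ρ₀ p.1 * q' p.1 p.2) := by
        refine withDensity_mono ((ae_restrict_iff' hE).2 (Filter.Eventually.of_forall ?_))
        intro p hp
        exact ENNReal.ofReal_le_ofReal (mul_le_mul_of_nonneg_left (hle p hp) (h₀.nonneg hρ _))
    _ = (jointLaw ρ₀ q').restrict E := by rw [jointLaw, restrict_withDensity hE]
    _ ≤ _ := Measure.restrict_le_self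

/-! ### Lower bounds for the Hilbert metric -/

lemma log_le_hilbertDist {d : ℕ} {S : Set (Fin d → ℝ)} {f g : (Fin d → ℝ) → ℝ} {K : ℝ≥0}
    (hK : 1 ≤ K)
    (h : ∀ l L : ℝ≥0, (∀ᵐ z ∂(volume.restrict S), l * g z ≤ f z) →
      (∀ᵐ z ∂(volume.restrict S), f z ≤ L * g z) → K * l ≤ L) :
    ENNReal.ofReal (Real.log K) ≤ hilbertDist S f g := by
  rw [hilbertDist]
  split_ifs with hcase
  · exact le_top
  · obtain ⟨hm, hM⟩ := not_or.1 hcase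
    have key : (K : ℝ≥0∞) * hilbertm S f g ≤ hilbertM S f g := by
      simp only [hilbertm, hilbertM, ENNReal.mul_iSup, iSup_le_iff, le_iInf_iff]
      rintro L ⟨-, hL⟩ l ⟨-, hl⟩
      exact_mod_cast h l L hl hL
    have hm_top : hilbertm S f g ≠ ⊤ := by
      refine ne_top_of_le_ne_top hM (le_trans ?_ key)
      exact le_mul_of_one_le_left (zero_le) (by exact_mod_cast hK)
    have hdiv : (K : ℝ≥0∞) ≤ hilbertM S f g / hilbertm S f g :=
      (ENNReal.le_div_iff_mul_le (Or.inl hm) (Or.inl hm_top)).2 key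
    have hreal : (K : ℝ) ≤ (hilbertM S f g / hilbertm S f g).toReal :=
      ENNReal.toReal_mono (ENNReal.div_ne_top hM hm) hdiv
    exact ENNReal.ofReal_le_ofReal
      (Real.log_le_log (by exact_mod_cast zero_lt_one.trans_le hK) hreal)

/-- If `g` is constant on two subsets of the cube, then the ratio of the averages of `f` over them
bounds the Hilbert distance of `f` and `g` from below. -/
lemma log_le_hilbertDist_of_averages {d : ℕ} {S T : Set (Fin d → ℝ)} {f g : (Fin d → ℝ) → ℝ}
    {K s t a b : ℝ≥0} (hK : 1 ≤ K) (hS : MeasurableSet S) (hT : MeasurableSet T)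
    (hSc : S ⊆ cube d) (hTc : T ⊆ cube d) (hS0 : volume S ≠ 0) (hT0 : volume T ≠ 0)
    (hgS : ∀ z ∈ S, g z = a) (hgT : ∀ z ∈ T, g z = b) (htb : t * b ≠ 0) (hst : s * a = K * (t * b))
    (hf : s * ((∫⁻ z in S, ENNReal.ofReal (f z)) * volume T) ≤
      t * ((∫⁻ z in T, ENNReal.ofReal (f z)) * volume S)) :
    ENNReal.ofReal (Real.log K) ≤ hilbertDist (cube d) f g := by
  have hfin : ∀ R ⊆ cube d, volume R ≠ ⊤ := fun R hR =>
    ne_top_of_le_ne_top (by simp [volume_cube]) (measure_mono hR)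
  refine log_le_hilbertDist hK fun l L hl hL => ?_
  have h1 : (l * a : ℝ≥0) * volume S ≤ ∫⁻ z in S, ENNReal.ofReal (f z) := by
    rw [← setLIntegral_const]
    refine setLIntegral_mono_ae' hS ?_
    rw [← ae_restrict_iff' hS]
    filter_upwards [ae_restrict_of_ae_restrict_of_subset hSc hl, ae_restrict_mem hS] with z hz hzS
    rw [hgS z hzS, ← NNReal.coe_mul] at hz
    exact (ENNReal.ofReal_coe_nnreal (p := l * a)).symm.le.trans (ENNReal.ofReal_le_ofReal hz)
  have h2 : ∫⁻ z in T, ENNReal.ofReal (f z) ≤ (L * b : ℝ≥0) * volume T := by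
    rw [← setLIntegral_const]
    refine setLIntegral_mono_ae' hT ?_
    rw [← ae_restrict_iff' hT]
    filter_upwards [ae_restrict_of_ae_restrict_of_subset hTc hL, ae_restrict_mem hT] with z hz hzT
    rw [hgT z hzT, ← NNReal.coe_mul] at hz
    exact (ENNReal.ofReal_le_ofReal hz).trans (ENNReal.ofReal_coe_nnreal (p := L * b)).le
  have h3 : ((s * (l * a) : ℝ≥0) : ℝ≥0∞) * (volume S * volume T) ≤
      ((t * (L * b) : ℝ≥0) : ℝ≥0∞) * (volume S * volume T) := by
    calc ((s * (l * a) : ℝ≥0) : ℝ≥0∞) * (volume S * volume T)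
        = s * ((l * a : ℝ≥0) * volume S * volume T) := by push_cast; ring
      _ ≤ s * ((∫⁻ z in S, ENNReal.ofReal (f z)) * volume T) := by gcongr
      _ ≤ t * ((∫⁻ z in T, ENNReal.ofReal (f z)) * volume S) := hf
      _ ≤ t * ((L * b : ℝ≥0) * volume T * volume S) := by gcongr
      _ = _ := by push_cast; ring
  have h4 := (ENNReal.mul_le_mul_iff_left (mul_ne_zero hS0 hT0)
    (ENNReal.mul_ne_top (hfin S hSc) (hfin T hTc))).1 h3
  have h5 : s * (l * a) ≤ t * (L * b) := by exact_mod_cast h4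
  have h6 : (K * l) * (t * b) ≤ L * (t * b) := by
    calc (K * l) * (t * b) = s * (l * a) := by
          rw [show s * (l * a) = l * (s * a) by ring, hst]; ring
      _ ≤ t * (L * b) := h5
      _ = _ := by ring
  exact le_of_mul_le_mul_right h6 (pos_iff_ne_zero.2 htb)

/-! ### A narrow dip in the terminal variable -/

/-- The centre of the unit cube. -/
noncomputable def center (d : ℕ) : Fin d → ℝ := fun _ => 1 / 2

/-- A continuous function with values in `[κ, 1]` that is `κ` on the ball of radius `h` about the
centre of the cube and `1` off the ball of radius `2 h`. -/
noncomputable def dip {d : ℕ} (κ h : ℝ) (z : Fin d → ℝ) : ℝ :=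
  1 - (1 - κ) * max 0 (min 1 (2 - ‖z - center d‖ / h))

lemma continuous_dip {d : ℕ} (κ h : ℝ) : Continuous (dip κ h : (Fin d → ℝ) → ℝ) := by
  unfold dip; fun_prop

lemma dip_le_one {d : ℕ} {κ : ℝ} (hκ : κ ≤ 1) (h : ℝ) (z : Fin d → ℝ) : dip κ h z ≤ 1 := by
  have : 0 ≤ (1 - κ) * max 0 (min 1 (2 - ‖z - center d‖ / h)) :=
    mul_nonneg (by linarith) (le_max_left _ _)
  unfold dip
  linarith

lemma le_dip {d : ℕ} {κ : ℝ} (hκ : κ ≤ 1) (h : ℝ) (z : Fin d → ℝ) : κ ≤ dip κ h z := by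
  have : (1 - κ) * max 0 (min 1 (2 - ‖z - center d‖ / h)) ≤ 1 - κ :=
    mul_le_of_le_one_right (by linarith) (max_le zero_le_one (min_le_left _ _))
  unfold dip
  linarith

lemma dip_eq_of_mem {d : ℕ} {κ h : ℝ} (hh : 0 < h) {z : Fin d → ℝ}
    (hz : z ∈ Metric.closedBall (center d) h) : dip κ h z = κ := by
  rw [mem_closedBall_iff_norm] at hz
  have h1 : ‖z - center d‖ / h ≤ 1 := (div_le_one hh).2 hz
  rw [dip, min_eq_left (by linarith), max_eq_right zero_le_one]
  ring

lemma dip_eq_one_of_notMem {d : ℕ} {κ h : ℝ} (hh : 0 < h) {z : Fin d → ℝ}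
    (hz : z ∉ Metric.closedBall (center d) (2 * h)) : dip κ h z = 1 := by
  rw [mem_closedBall_iff_norm, not_le] at hz
  have h1 : 2 ≤ ‖z - center d‖ / h := (le_div_iff₀ hh).2 hz.le
  rw [dip, max_eq_left ((min_le_right _ _).trans (by linarith))]
  ring

lemma closedBall_center_subset {d : ℕ} {r : ℝ} (hr : r ≤ 1 / 2) :
    Metric.closedBall (center d) r ⊆ cube d := by
  intro z hz
  rw [mem_closedBall_iff_norm] at hz
  have h1 : ∀ i, |z i - 1 / 2| ≤ 1 / 2 := fun i =>
    ((norm_le_pi_norm (z - center d) i).trans hz).trans hr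
  exact ⟨fun i => by simpa using (abs_le.1 (h1 i)).1, fun i => by
    have := (abs_le.1 (h1 i)).2
    simp only [Pi.one_apply]
    linarith⟩

lemma volume_closedBall_center_le {d : ℕ} (hd : 1 ≤ d) {r : ℝ} (hr : 0 ≤ r) (hr1 : 2 * r ≤ 1) :
    volume (Metric.closedBall (center d) r) ≤ ENNReal.ofReal (2 * r) := by
  rw [Real.volume_pi_closedBall _ hr, Fintype.card_fin]
  exact ENNReal.ofReal_le_ofReal (pow_le_of_le_one (by positivity) hr1 (by omega))

/-! ### The minimax bound -/

/-- The minimax risk does not tend to zero: without control of `z ↦ q x z`, the fixed point of a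
splitting density can be lowered by a fixed factor on a ball so small that a sample of size `N`
typically misses it. -/
theorem log_sqrt_le_minimaxRisk {d : ℕ} (hd : 1 ≤ d) {α qmin qlow qmax B ρmin ρmax : ℝ}
    (hqmin : 0 < qmin) (hqlow : qmin < qlow) (hρmin : 0 < ρmin) {ρ₀ ρT : (Fin d → ℝ) → ℝ}
    (h₀ : IsCubeDensity ρmin ρmax ρ₀) (hT : IsCubeDensity ρmin ρmax ρT)
    (hne : ∃ q, InClass α qlow qmax B ρ₀ q) {N : ℕ} (hN : 1 ≤ N) :
    ENNReal.ofReal (Real.log √(qlow / qmin) / 4) ≤ minimaxRisk N α qmin qmax B ρ₀ ρT := by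
  obtain ⟨q, hq⟩ := hne
  have hlow : 0 < qlow := hqmin.trans hqlow
  obtain ⟨w, τ, ψ, hs, hw, hB⟩ := hq.exists_isSplitting hd hlow
  -- The depth of the dip is the ratio of the two lower bounds on the class.
  obtain ⟨κ, hκ⟩ : ∃ κ : ℝ, κ = qmin / qlow := ⟨_, rfl⟩
  have hκ0 : 0 < κ := hκ ▸ div_pos hqmin hlow
  have hκ1 : κ ≤ 1 := hκ ▸ (div_le_one hlow).2 hqlow.le
  have hqκ : qlow * κ = qmin := by rw [hκ]; field_simp
  obtain ⟨K, hKcoe⟩ : ∃ K : ℝ≥0, (K : ℝ) = √(qlow / qmin) :=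
    ⟨_, Real.coe_toNNReal _ (Real.sqrt_nonneg _)⟩
  have hK1 : 1 ≤ K := by
    rw [← NNReal.coe_le_coe, hKcoe, NNReal.coe_one, Real.one_le_sqrt]
    exact (one_le_div hqmin).2 hqlow.le
  have hKκ : (K : ℝ) * K * κ = 1 := by
    rw [hKcoe, Real.mul_self_sqrt (by positivity), hκ]
    field_simp
  -- At this radius the dip has probability at most `1 / (2 N)`.
  obtain ⟨h, hh⟩ : ∃ h : ℝ, h = 1 / (8 * N) := ⟨_, rfl⟩
  have hN' : (1 : ℝ) ≤ N := by exact_mod_cast hN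
  have hh0 : 0 < h := hh ▸ by positivity
  have hhN : N * (4 * h) = 1 / 2 := by rw [hh]; field_simp; norm_num
  have hh1 : 4 * h ≤ 1 / 2 := by nlinarith
  set D := Metric.closedBall (center d) (2 * h) with hD
  have hDm : MeasurableSet D := Metric.isClosed_closedBall.measurableSet
  have hDc : D ⊆ cube d := closedBall_center_subset (by linarith)
  have hDvol : volume D ≤ ENNReal.ofReal (4 * h) := by
    convert volume_closedBall_center_le hd (r := 2 * h) (by linarith) (by linarith) using 2
    ring
  let r₀ : (Fin d → ℝ) → ℝ := fun _ => 1
  let r₁ : (Fin d → ℝ) → ℝ := dip κ h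
  have hr₀ : Continuous r₀ := continuous_const
  have hr₁ : Continuous r₁ := continuous_dip κ h
  have hr₀0 : ∀ z, 0 < r₀ z := fun _ => one_pos
  have hr₀1 : ∀ z, r₀ z ≤ 1 := fun _ => le_rfl
  have hr₁0 : ∀ z, 0 < r₁ z := fun z => hκ0.trans_le (le_dip hκ1 h z)
  have hr₁1 : ∀ z, r₁ z ≤ 1 := fun z => dip_le_one hκ1 h z
  set q₀ := splitDensity w τ ψ r₀ with hq₀
  set q₁ := splitDensity w τ ψ r₁ with hq₁
  have hc₀ : InClass α qmin qmax B ρ₀ q₀ := hs.inClass hr₀ hr₀0 hr₀1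
    (fun z => by simpa [r₀] using hqlow.le) hw hB
  have hc₁ : InClass α qmin qmax B ρ₀ q₁ := hs.inClass hr₁ hr₁0 hr₁1
    (fun z => hqκ ▸ mul_le_mul_of_nonneg_left (le_dip hκ1 h z) hlow.le) hw hB
  have hf₀ := hs.isFixedPoint hr₀ hr₀0 h₀ hT
  have hf₁ := hs.isFixedPoint hr₁ hr₁0 h₀ hT
  have hI₀ := IsSplitting.setIntegral_pos hr₀ hr₀0
  have hI₁ := IsSplitting.setIntegral_pos hr₁ hr₁0
  set I₀ := ∫ y in cube d, r₀ y
  set I₁ := ∫ y in cube d, r₁ y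
  have hw1 : ∀ x, w x ≤ 1 := by
    intro x
    have hτ1 : 1 ≤ ∫ z, τ z := by
      calc (1 : ℝ) = ∫ z in cube d, τ z := by
            rw [setIntegral_congr_fun (measurableSet_cube d) hs.τ_eq_one]
            simp [measureReal_def]
        _ ≤ ∫ z, τ z := setIntegral_le_integral hs.τ_integrable
            (Filter.Eventually.of_forall hs.τ_nonneg)
    exact (le_mul_of_one_le_right (hs.w_pos x).le hτ1).trans (hs.mass_lt_one x).le
  -- Comparison of the two joint laws.
  set μ := jointLaw ρ₀ q₀ with hμ
  set ν := jointLaw ρ₀ q₁ with hν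
  have : IsProbabilityMeasure μ := isProbabilityMeasure_jointLaw hρmin h₀ hc₀.transition
  set E : Set ((Fin d → ℝ) × (Fin d → ℝ)) := (Prod.snd ⁻¹' D)ᶜ with hE
  have hEm : MeasurableSet E := (measurable_snd hDm).compl
  have hdom : μ.restrict E ≤ ν := by
    refine restrict_jointLaw_le hρmin h₀ hEm fun p hp => ?_
    exact hs.splitDensity_le hr₀ hr₀0 hr₀1 hr₁ hr₁0 hr₁1 p.1 (dip_eq_one_of_notMem hh0 hp)
  have hμE : N * μ Eᶜ ≤ 1 / 2 := by
    have h1 : μ Eᶜ ≤ ENNReal.ofReal (4 * h) := by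
      rw [hE, compl_compl]
      refine (jointLaw_snd_mem_le hρmin h₀ hc₀.transition hDm fun x z hz => ?_).trans hDvol
      rw [hq₀, hs.eq_on_cube r₀ x (hDc hz)]
      simpa [r₀] using hw1 x
    calc N * μ Eᶜ ≤ ENNReal.ofReal N * ENNReal.ofReal (4 * h) := by
          rw [ENNReal.ofReal_natCast]
          gcongr
      _ = ENNReal.ofReal (1 / 2) := by rw [← ENNReal.ofReal_mul (by positivity), hhN]
      _ = 1 / 2 := by rw [ENNReal.ofReal_div_of_pos two_pos]; simp
  -- The two regions where the averages of an estimator are compared.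
  set S₁ := Metric.closedBall (center d) h with hS₁
  set S₀ := cube d \ D with hS₀
  have hS₁m : MeasurableSet S₁ := Metric.isClosed_closedBall.measurableSet
  have hS₀m : MeasurableSet S₀ := (measurableSet_cube d).diff hDm
  have hS₁c : S₁ ⊆ cube d := closedBall_center_subset (by linarith)
  have hS₀c : S₀ ⊆ cube d := sdiff_subset
  have hS₁0 : volume S₁ ≠ 0 := (Metric.measure_closedBall_pos volume _ hh0).ne'
  have hS₀0 : volume S₀ ≠ 0 := by
    have h1 : volume D < volume (cube d) := by
      rw [volume_cube]
      exact hDvol.trans_lt (ENNReal.ofReal_lt_one.2 (by linarith))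
    exact ((tsub_pos_of_lt h1).trans_le le_measure_sdiff).ne'
  rw [minimaxRisk]
  refine le_iInf₂ fun ghat hghat => ?_
  set R := ⨆ (q : (Fin d → ℝ) → (Fin d → ℝ) → ℝ) (_ : InClass α qmin qmax B ρ₀ q)
    (g : (Fin d → ℝ) → ℝ) (_ : IsFixedPoint ρ₀ ρT q g),
    ∫⁻ ω, hilbertDist (cube d) (ghat ω) g ∂(sampleLaw N ρ₀ q)
  have hR : ∀ {q g}, InClass α qmin qmax B ρ₀ q → IsFixedPoint ρ₀ ρT q g →
      ∫⁻ ω, hilbertDist (cube d) (ghat ω) g ∂(sampleLaw N ρ₀ q) ≤ R := by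
    intro q g hqc hg
    exact le_iSup₂_of_le q hqc (le_iSup₂_of_le g hg le_rfl)
  let a (S : Set (Fin d → ℝ)) (ω : Fin N → (Fin d → ℝ) × (Fin d → ℝ)) : ℝ≥0∞ :=
    ∫⁻ z in S, ENNReal.ofReal (ghat ω z)
  have ha : ∀ S, Measurable (a S) := fun S =>
    hghat.ennreal_ofReal.lintegral_prod_right'
  let A : Set (Fin N → (Fin d → ℝ) × (Fin d → ℝ)) :=
    {ω | a S₀ ω * volume S₁ ≤ K * (a S₁ ω * volume S₀)}
  have hA : MeasurableSet A := measurableSet_le ((ha _).mul_const _)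
    (((ha _).mul_const _).const_mul _)
  set s := ENNReal.ofReal (Real.log K) with hsdef
  have htest := one_le_testing_errors N hEm hdom hA
  -- An estimate without a dip errs under `q₁`, an estimate with a dip errs under `q₀`.
  have hR₁ : s * Measure.pi (fun _ => ν) A ≤ R := by
    refine le_trans ?_ (hR hc₁ hf₁)
    rw [← setLIntegral_const]
    refine (setLIntegral_mono' hA fun ω hω => ?_).trans (setLIntegral_le_lintegral A _)
    refine log_le_hilbertDist_of_averages (S := S₀) (T := S₁) (s := 1) (t := K)
      (a := (1 / I₁).toNNReal) (b := (κ / I₁).toNNReal) hK1 hS₀m hS₁m hS₀c hS₁c hS₀0 hS₁0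
      (fun z hz => ?_) (fun z hz => ?_) ?_ ?_ (by rw [ENNReal.coe_one, one_mul]; exact hω)
    · rw [Real.coe_toNNReal _ (by positivity)]
      simp only [r₁, dip_eq_one_of_notMem hh0 hz.2]
    · rw [Real.coe_toNNReal _ (by positivity)]
      simp only [r₁, dip_eq_of_mem hh0 hz]
    · exact mul_ne_zero (zero_lt_one.trans_le hK1).ne' (Real.toNNReal_pos.2 (by positivity)).ne'
    · rw [← NNReal.coe_inj]
      push_cast
      rw [Real.coe_toNNReal _ (by positivity), Real.coe_toNNReal _ (by positivity)]
      calc 1 * (1 / I₁) = (K * K * κ) * (1 / I₁) := by rw [hKκ]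
        _ = _ := by ring
  have hR₀ : s * Measure.pi (fun _ => μ) Aᶜ ≤ R := by
    refine le_trans ?_ (hR hc₀ hf₀)
    rw [← setLIntegral_const]
    refine (setLIntegral_mono' hA.compl fun ω hω => ?_).trans (setLIntegral_le_lintegral Aᶜ _)
    have hgconst : ∀ z : Fin d → ℝ, r₀ z / I₀ = ((1 / I₀).toNNReal : ℝ) := fun z =>
      (Real.coe_toNNReal _ (by positivity)).symm
    refine log_le_hilbertDist_of_averages (S := S₁) (T := S₀) (s := K) (t := 1)
      (a := (1 / I₀).toNNReal) (b := (1 / I₀).toNNReal) hK1 hS₁m hS₀m hS₁c hS₀c hS₁0 hS₀0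
      (fun z _ => hgconst z) (fun z _ => hgconst z) ?_ (by rw [one_mul]) ?_
    · rw [one_mul]
      exact (Real.toNNReal_pos.2 (by positivity)).ne'
    · rw [ENNReal.coe_one, one_mul]
      exact (not_le.1 (show ¬a S₀ ω * volume S₁ ≤ K * (a S₁ ω * volume S₀) from hω)).le
  have hhalf : 1 / 2 ≤ Measure.pi (fun _ => μ) Aᶜ + Measure.pi (fun _ => ν) A := by
    have h1 : (1 : ℝ≥0∞) ≤ Measure.pi (fun _ => μ) Aᶜ + Measure.pi (fun _ => ν) A + 1 / 2 :=
      htest.trans (by gcongr)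
    have h2 : (1 : ℝ≥0∞) / 2 + 1 / 2 = 1 := ENNReal.add_halves 1
    exact (ENNReal.add_le_add_iff_right (a := 1 / 2) (by simp)).1 (h2.trans_le h1)
  have hfinal : s * (1 / 2) ≤ R * 2 := by
    calc s * (1 / 2) ≤ s * (Measure.pi (fun _ => μ) Aᶜ + Measure.pi (fun _ => ν) A) := by gcongr
      _ = s * Measure.pi (fun _ => μ) Aᶜ + s * Measure.pi (fun _ => ν) A := mul_add _ _ _
      _ ≤ R + R := add_le_add hR₀ hR₁
      _ = R * 2 := (mul_two R).symm
  have hquarter : ENNReal.ofReal (Real.log √(qlow / qmin) / 4) = s * (1 / 2) / 2 := by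
    rw [← hKcoe, show Real.log K / 4 = Real.log K * (1 / 2) / 2 by ring,
      ENNReal.ofReal_div_of_pos two_pos,
      ENNReal.ofReal_mul' (by norm_num), ENNReal.ofReal_div_of_pos two_pos]
    simp [hsdef]
  rw [hquarter]
  exact ENNReal.div_le_of_le_mul hfinal

end SchrodingerBridge

theorem mainTheorem3 (d : ℕ) (hd : 1 ≤ d) (α : ℝ) (hα : 0 < α) (hα1 : α ≤ 1)
    (qmin qlow qmax B ρmin ρmax : ℝ) (hqmin : 0 < qmin) (hqlow : qmin < qlow)
    (hρmin : 0 < ρmin) :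
    ∃ c : ℝ, 0 < c ∧
      ∀ ρ₀ ρT : (Fin d → ℝ) → ℝ,
        SchrodingerBridge.IsCubeDensity ρmin ρmax ρ₀ →
        SchrodingerBridge.IsCubeDensity ρmin ρmax ρT →
        (∃ q, SchrodingerBridge.InClass α qlow qmax B ρ₀ q) →
        ∀ N : ℕ, 1 ≤ N →
          ENNReal.ofReal (c * (N : ℝ) ^ (-((1 + α) / (2 * (1 + α) + d)))) ≤
            SchrodingerBridge.minimaxRisk N α qmin qmax B ρ₀ ρT := by
  have hlog : 0 < Real.log √(qlow / qmin) :=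
    Real.log_pos ((Real.lt_sqrt zero_le_one).2 (by rw [one_pow]; exact (one_lt_div hqmin).2 hqlow))
  refine ⟨Real.log √(qlow / qmin) / 4, by positivity, fun ρ₀ ρT h₀ hT hne N hN => ?_⟩
  refine le_trans (ENNReal.ofReal_le_ofReal ?_)
    (SchrodingerBridge.log_sqrt_le_minimaxRisk hd hqmin hqlow hρmin h₀ hT hne hN)
  have hpow : (N : ℝ) ^ (-((1 + α) / (2 * (1 + α) + d))) ≤ 1 :=
    Real.rpow_le_one_of_one_le_of_nonpos (by exact_mod_cast hN) (neg_nonpos.2 (by positivity))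
  exact mul_le_of_le_one_right (by positivity) hpow
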